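/- For $n \ge 1$ and $z \in \mathbb{C}$ let $\zeta_n(z) := \sum_{k=1}^{n} \frac{1}{k^{z}}$ be the $n$th partial sum of the Riemann zeta function, where $k^{z} = e^{z \log k}$ with the real logarithm of $k$. For every integer $n \ge 3$, the function $\zeta_n$ has infinitely many zeros in the half-plane $\{z \in \mathbb{C} : \operatorname{Re} z < 0\}$ and infinitely many zeros in the half-plane $\{z \in \mathbb{C} : \operatorname{Re} z > 0\}$. For $n = 2$, all zeros of $\zeta_2$ lie on the imaginary axis $\{z \in \mathbb{C} : \operatorname{Re} z = 0\}$. -/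

import Mathlib

/-- The `n`-th partial sum `ζ_n(z) = ∑_{k=1}^n 1 / k^z` of the Riemann zeta function. Since the
bases `k` are positive, `(k : ℂ) ^ z` is `exp (z log k)` with the real logarithm of `k`. -/
noncomputable def zetaPartialSum (n : ℕ) (z : ℂ) : ℂ :=
  ∑ k ∈ Finset.Icc 1 n, 1 / (k : ℂ) ^ z

/-! Take a prime `p` with `p < n < 2 * p`, so that `p` divides no other `k ≤ n`. Since logarithms of
primes are independent over the integers, Kronecker's theorem gives arbitrarily large `t` with `p ^
(-it)` near a prescribed unimodular `v` and every other `k ^ (-it)` near 1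
(`exists_gt_forall_norm_exp_sub_lt`). Vertical translates of the partial sum thus approximate the
sum whose `p`-th term is multiplied by `v`, and a Hurwitz argument turns one zero `w` of the latter
into infinitely many zeros near the line through `w` (`infinite_zeros_near`).

Some `v` gives a zero at `w` exactly when the `p`-th term balances the sum of the others in absolute
value. Such a `w` exists in each half-plane: otherwise continuity and Phragmén–Lindelöf would bound
a normalized sum of the others below by 1, which fails where its leading nonconstant term is
negative (`exists_norm_expPoly_eq`). -/

open Complex Filter Topology MeasureTheory UnitAddTorus

/-! ### Exponential polynomials on the right half-plane -/

/-- A generalized Dirichlet polynomial `1 + ∑ exp (-λᵢ z)` with constant term and coefficients `1`. -/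
noncomputable def expPoly {ι : Type*} (S : Finset ι) (lam : ι → ℝ) (z : ℂ) : ℂ :=
  1 + ∑ i ∈ S, exp (-(lam i : ℂ) * z)

theorem differentiable_expPoly {ι : Type*} (S : Finset ι) (lam : ι → ℝ) :
    Differentiable ℂ (expPoly S lam) := by
  unfold expPoly
  fun_prop

theorem norm_exp_neg_mul (a : ℝ) (z : ℂ) : ‖exp (-(a : ℂ) * z)‖ = Real.exp (-a * z.re) := by
  rw [Complex.norm_exp]
  simp

theorem one_le_norm_expPoly_ofReal {ι : Type*} (S : Finset ι) (lam : ι → ℝ) (x : ℝ) :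
    1 + ∑ i ∈ S, Real.exp (-lam i * x) ≤ ‖expPoly S lam x‖ := by
  have h : expPoly S lam x = ((1 + ∑ i ∈ S, Real.exp (-lam i * x) : ℝ) : ℂ) := by
    simp [expPoly]
  rw [h, Complex.norm_real]
  exact le_abs_self _

/-- Far to the right the smallest frequency dominates the other nonconstant terms; on the line `im z
= π / lam j` its term is negative real and pulls the sum below 1. -/
theorem exists_norm_expPoly_lt_one {ι : Type*} (S : Finset ι) (lam : ι → ℝ)
    (hS : S.Nonempty) (hpos : ∀ i ∈ S, 0 < lam i) (hinj : Set.InjOn lam S) :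
    ∃ z : ℂ, 0 < z.re ∧ ‖expPoly S lam z‖ < 1 := by
  classical
  obtain ⟨j, hj, hmin⟩ := S.exists_min_image lam hS
  have hlt : ∀ i ∈ S.erase j, 0 < lam i - lam j := by
    intro i hi
    rw [Finset.mem_erase] at hi
    exact sub_pos.2 ((hmin i hi.2).lt_of_ne fun h => hi.1 (hinj hi.2 hj h.symm))
  have htend : Tendsto (fun x : ℝ => ∑ i ∈ S.erase j, Real.exp (-(lam i - lam j) * x))
      atTop (𝓝 0) := by
    rw [← Finset.sum_const_zero (s := S.erase j)]
    refine tendsto_finsetSum _ fun i hi => ?_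
    refine Real.tendsto_exp_atBot.comp ?_
    exact (tendsto_id.const_mul_atTop_of_neg (neg_lt_zero.2 (hlt i hi)))
  obtain ⟨x, hx1, hx0⟩ :=
    ((htend.eventually (gt_mem_nhds one_pos)).and (eventually_gt_atTop 0)).exists
  have hl := hpos j hj
  have hlC : (lam j : ℂ) ≠ 0 := by exact_mod_cast hl.ne'
  refine ⟨x + (Real.pi / lam j : ℝ) * I, by simpa using hx0, ?_⟩
  set z : ℂ := x + (Real.pi / lam j : ℝ) * I with hz
  have hzre : z.re = x := by simp [hz]
  have hj' : exp (-(lam j : ℂ) * z) = -(Real.exp (-lam j * x) : ℝ) := by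
    have : -(lam j : ℂ) * z = ((-lam j * x : ℝ) : ℂ) - Real.pi * I := by
      rw [hz]; push_cast; field_simp; ring
    rw [this, Complex.exp_sub, Complex.exp_pi_mul_I, Complex.ofReal_exp]
    ring
  have hle1 : Real.exp (-lam j * x) ≤ 1 := by
    rw [Real.exp_le_one_iff]; nlinarith
  have hsum : ‖∑ i ∈ S.erase j, exp (-(lam i : ℂ) * z)‖ < Real.exp (-lam j * x) := by
    calc _ ≤ ∑ i ∈ S.erase j, ‖exp (-(lam i : ℂ) * z)‖ := norm_sum_le _ _
      _ = Real.exp (-lam j * x) * ∑ i ∈ S.erase j, Real.exp (-(lam i - lam j) * x) := by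
        rw [Finset.mul_sum]
        refine Finset.sum_congr rfl fun i _ => ?_
        rw [norm_exp_neg_mul, hzre, ← Real.exp_add]
        ring_nf
      _ < Real.exp (-lam j * x) * 1 := by gcongr
      _ = _ := mul_one _
  calc ‖expPoly S lam z‖
      = ‖((1 - Real.exp (-lam j * x) : ℝ) : ℂ) + ∑ i ∈ S.erase j, exp (-(lam i : ℂ) * z)‖ := by
        rw [expPoly, ← Finset.add_sum_erase S _ hj, hj', Complex.ofReal_sub,
          Complex.ofReal_one, ← add_assoc, ← sub_eq_add_neg]
    _ ≤ ‖((1 - Real.exp (-lam j * x) : ℝ) : ℂ)‖ + ‖∑ i ∈ S.erase j, exp (-(lam i : ℂ) * z)‖ :=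
        norm_add_le _ _
    _ < (1 - Real.exp (-lam j * x)) + Real.exp (-lam j * x) := by
        rw [Complex.norm_real, Real.norm_of_nonneg (by linarith)]
        gcongr
    _ = 1 := by ring

/-- If `|expPoly|` exceeds `exp (-μ re z)` on the right half-plane then, by Phragmén–Lindelöf,
it is at least `exp (-μ ε)` to the right of the line `re z = ε`. -/
theorem exp_neg_le_norm_expPoly {ι : Type*} (S : Finset ι) (lam : ι → ℝ) {mu : ℝ} (hmu : 0 < mu)
    (h : ∀ z : ℂ, 0 < z.re → Real.exp (-mu * z.re) < ‖expPoly S lam z‖)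
    {ε : ℝ} (hε : 0 < ε) {z : ℂ} (hz : ε ≤ z.re) :
    Real.exp (-mu * ε) ≤ ‖expPoly S lam z‖ := by
  -- The shift by `ε` makes the reciprocal regular up to the boundary, where it is bounded by `exp
  -- (mu * ε)`.
  set F : ℂ → ℂ := fun w => (expPoly S lam (w + ε))⁻¹ with hF
  have hbd : ∀ w : ℂ, 0 ≤ w.re → ‖F w‖ ≤ Real.exp (mu * (w.re + ε)) := by
    intro w hw
    have := h (w + ε) (by simp; linarith)
    rw [hF]
    simp only [norm_inv]
    rw [← inv_inv (Real.exp (mu * _)), ← Real.exp_neg]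
    refine inv_anti₀ (Real.exp_pos _) ?_
    simpa using this.le
  have hd : DiffContOnCl ℂ F {w | 0 < w.re} := by
    refine DifferentiableOn.diffContOnCl ?_
    rw [Complex.closure_setOfPred_lt_re]
    intro w hw
    have hw' : 0 ≤ w.re := hw
    have hne : expPoly S lam (w + ε) ≠ 0 := by
      rw [← norm_pos_iff]
      exact (Real.exp_pos _).trans (h (w + ε) (by simp; linarith))
    refine DifferentiableAt.differentiableWithinAt (DifferentiableAt.inv ?_ hne)
    exact ((differentiable_expPoly S lam).comp (differentiable_id.add_const _)) w
  have key : ‖F (z - ε)‖ ≤ Real.exp (mu * ε) := by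
    refine PhragmenLindelof.right_half_plane_of_bounded_on_real hd ⟨1, by norm_num, mu, ?_⟩ ?_ ?_
      (by simpa using hz)
    · refine Asymptotics.IsBigO.of_bound (Real.exp (mu * ε)) ?_
      refine eventually_inf_principal.2 (Eventually.of_forall fun w hw => ?_)
      have hw' : 0 < w.re := hw
      refine (hbd w hw'.le).trans ?_
      rw [Real.norm_of_nonneg (Real.exp_pos _).le, ← Real.exp_add, Real.rpow_one]
      have := Complex.re_le_norm w
      gcongr
      nlinarith
    · refine ⟨1, ?_⟩
      refine eventually_map.2 (Eventually.of_forall fun x => ?_)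
      have := one_le_norm_expPoly_ofReal S lam (x + ε)
      have h0 : 0 ≤ ∑ i ∈ S, Real.exp (-lam i * (x + ε)) :=
        Finset.sum_nonneg fun i _ => (Real.exp_pos _).le
      simp only [hF, norm_inv]
      refine inv_le_one_of_one_le₀ ?_
      push_cast at this
      linarith
    · intro x
      simpa using hbd (x * I) (by simp)
  simp only [hF, sub_add_cancel, norm_inv] at key
  have h0 : 0 < ‖expPoly S lam z‖ := (Real.exp_pos _).trans (h z (hε.trans_le hz))
  rw [neg_mul, Real.exp_neg]
  exact inv_le_of_inv_le₀ h0 key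

/-- Without equality, connectedness spreads the strict inequality from the point 1 to the whole
half-plane; letting `ε → 0` in the Phragmén–Lindelöf bound then contradicts
`exists_norm_expPoly_lt_one`. -/
theorem exists_norm_expPoly_eq {ι : Type*} (S : Finset ι) (lam : ι → ℝ)
    (hS : S.Nonempty) (hpos : ∀ i ∈ S, 0 < lam i) (hinj : Set.InjOn lam S)
    {mu : ℝ} (hmu : 0 < mu) :
    ∃ z : ℂ, 0 < z.re ∧ ‖expPoly S lam z‖ = Real.exp (-mu * z.re) := by
  by_contra! hne
  have hcont : Continuous fun z : ℂ => ‖expPoly S lam z‖ - Real.exp (-mu * z.re) := by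
    have := (differentiable_expPoly S lam).continuous
    fun_prop
  have hconn : IsPreconnected {z : ℂ | 0 < z.re} := (convex_halfSpace_re_gt 0).isPreconnected
  have hgt : ∀ z : ℂ, 0 < z.re → Real.exp (-mu * z.re) < ‖expPoly S lam z‖ := by
    intro z hz
    by_contra! hle
    have h1 : 0 ≤ ‖expPoly S lam (1 : ℝ)‖ - Real.exp (-mu * ((1 : ℝ) : ℂ).re) := by
      have := one_le_norm_expPoly_ofReal S lam 1
      have h0 : 0 ≤ ∑ i ∈ S, Real.exp (-lam i * 1) :=
        Finset.sum_nonneg fun i _ => (Real.exp_pos _).le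
      have h2 : Real.exp (-mu * ((1 : ℝ) : ℂ).re) ≤ 1 := by
        rw [Real.exp_le_one_iff]; simp; linarith
      linarith
    obtain ⟨w, hw, hw0⟩ := hconn.intermediate_value (a := z) (b := ((1 : ℝ) : ℂ)) hz
      (by simp) hcont.continuousOn ⟨sub_nonpos.2 hle, h1⟩
    exact hne w hw (sub_eq_zero.1 hw0)
  obtain ⟨z, hz, hz1⟩ := exists_norm_expPoly_lt_one S lam hS hpos hinj
  have hlim : Tendsto (fun ε : ℝ => Real.exp (-mu * ε)) (𝓝[>] 0) (𝓝 1) := by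
    have : Continuous fun ε : ℝ => Real.exp (-mu * ε) := by fun_prop
    simpa using (this.tendsto 0).mono_left nhdsWithin_le_nhds
  have : (1 : ℝ) ≤ ‖expPoly S lam z‖ := by
    refine le_of_tendsto hlim ?_
    filter_upwards [Ioo_mem_nhdsGT hz] with ε hε
    exact exp_neg_le_norm_expPoly S lam hmu hgt hε.1 hε.2.le
  linarith

/-! ### Kronecker's theorem by equidistribution -/

/-- The linear flow on the torus with frequencies `lam`. -/
def linearFlow {d : Type*} (lam : d → ℝ) (t : ℝ) : UnitAddTorus d :=
  fun i => ((t * lam i : ℝ) : UnitAddCircle)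

theorem continuous_linearFlow {d : Type*} (lam : d → ℝ) : Continuous (linearFlow lam) :=
  continuous_pi fun _ => (AddCircle.continuous_mk' 1).comp (continuous_id.mul_const _)

section
variable {d : Type*} [Fintype d]

theorem mFourier_add_apply (m : d → ℤ) (x y : UnitAddTorus d) :
    mFourier m (x + y) = mFourier m x * mFourier m y := by
  simp [mFourier, Finset.prod_mul_distrib, fourier_apply, smul_add, AddCircle.toCircle_add]

theorem mFourier_linearFlow (m : d → ℤ) (lam : d → ℝ) (t : ℝ) :
    mFourier m (linearFlow lam t) =
      exp ((2 * Real.pi * (∑ i, m i * lam i) : ℝ) * I * t) := by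
  simp only [mFourier, linearFlow, ContinuousMap.coe_mk, fourier_coe_apply]
  rw [← Complex.exp_sum]
  congr 1
  push_cast
  rw [Finset.mul_sum, Finset.sum_mul, Finset.sum_mul]
  refine Finset.sum_congr rfl fun i _ => ?_
  ring

noncomputable local instance : MeasurableSpace (UnitAddTorus d) := borel _
local instance : BorelSpace (UnitAddTorus d) := ⟨rfl⟩

theorem integral_mFourier_eq_zero {lam : d → ℝ} {m : d → ℤ} (hm : ∑ i, m i * lam i ≠ 0)
    (μ : Measure (UnitAddTorus d)) [μ.IsAddRightInvariant] :
    ∫ x, mFourier m x ∂μ = 0 := by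
  set s := ∑ i, m i * lam i
  -- Translation by the flow at time `1 / (2 * s)` multiplies the character by -1.
  have h := integral_add_right_eq_self (μ := μ) (fun x => mFourier m x)
    (linearFlow lam (1 / (2 * s)))
  simp only [mFourier_add_apply] at h
  rw [integral_mul_const, mFourier_linearFlow] at h
  have hs : (s : ℂ) ≠ 0 := by exact_mod_cast hm
  have h1 : ((2 * Real.pi * s : ℝ) : ℂ) * I * ((1 / (2 * s) : ℝ) : ℂ) = Real.pi * I := by
    push_cast; field_simp
  rw [h1, Complex.exp_pi_mul_I] at h
  linear_combination (-1 / 2 : ℂ) * h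

theorem tendsto_mean_exp {s : ℝ} (hs : s ≠ 0) (a : ℝ) :
    Tendsto (fun T : ℝ => (T : ℂ)⁻¹ * ∫ t in a..a + T, exp ((s : ℂ) * I * t)) atTop (𝓝 0) := by
  have hc : (s : ℂ) * I ≠ 0 := mul_ne_zero (by exact_mod_cast hs) I_ne_zero
  have hb : ∀ u : ℝ, ‖exp ((s : ℂ) * I * u)‖ = 1 := fun u => by
    rw [Complex.norm_exp]; simp
  refine squeeze_zero_norm (a := fun T : ℝ => |T|⁻¹ * (2 / ‖(s : ℂ) * I‖)) (fun T => ?_) ?_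
  · rw [integral_exp_mul_complex hc, norm_mul, norm_inv, Complex.norm_real, Real.norm_eq_abs,
      norm_div]
    gcongr
    refine (norm_sub_le _ _).trans ?_
    rw [hb, hb]; norm_num
  · simpa using (tendsto_inv_atTop_zero.comp tendsto_abs_atTop_atTop).mul_const
      (2 / ‖(s : ℂ) * I‖)

theorem tendsto_mean_linearFlow {lam : d → ℝ}
    (hlam : ∀ m : d → ℤ, ∑ i, m i * lam i = 0 → m = 0) (a : ℝ)
    (μ : Measure (UnitAddTorus d)) [μ.IsAddRightInvariant] [IsProbabilityMeasure μ]
    {h : C(UnitAddTorus d, ℂ)} (hh : h ∈ Submodule.span ℂ (Set.range (mFourier (d := d)))) :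
    Tendsto (fun T : ℝ => (T : ℂ)⁻¹ * ∫ t in a..a + T, h (linearFlow lam t)) atTop
      (𝓝 (∫ x, h x ∂μ)) := by
  have hint : ∀ (f : C(UnitAddTorus d, ℂ)) (u v : ℝ),
      IntervalIntegrable (fun t => f (linearFlow lam t)) volume u v := fun f u v =>
    (f.continuous.comp (continuous_linearFlow lam)).intervalIntegrable u v
  have hint' : ∀ f : C(UnitAddTorus d, ℂ), Integrable (fun x => f x) μ := fun f =>
    f.continuous.integrable_of_hasCompactSupport (HasCompactSupport.of_compactSpace _)
  induction hh using Submodule.span_induction with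
  | mem f hf =>
    obtain ⟨m, rfl⟩ := hf
    by_cases hm : m = 0
    · subst hm
      simp only [mFourier_zero, ContinuousMap.one_apply, intervalIntegral.integral_const,
        integral_const, probReal_univ, add_sub_cancel_left]
      refine tendsto_const_nhds.congr' ?_
      filter_upwards [eventually_gt_atTop 0] with T hT
      have : (T : ℂ) ≠ 0 := by exact_mod_cast hT.ne'
      simp [this]
    · have hs : ∑ i, m i * lam i ≠ 0 := fun h => hm (hlam m h)
      rw [integral_mFourier_eq_zero hs μ]
      simp only [mFourier_linearFlow]
      exact tendsto_mean_exp (by positivity) a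
  | zero => simp
  | add f g _ _ hf hg =>
    simp only [ContinuousMap.add_apply]
    rw [integral_add (hint' f) (hint' g)]
    refine (hf.add hg).congr fun T => ?_
    rw [intervalIntegral.integral_add (hint f _ _) (hint g _ _), mul_add]
  | smul c f _ hf =>
    simp only [ContinuousMap.smul_apply, smul_eq_mul]
    rw [integral_const_mul]
    refine (hf.const_mul c).congr fun T => ?_
    rw [intervalIntegral.integral_const_mul]
    ring

/-- **Kronecker's theorem**: a linear flow on the torus with rationally independent frequencies
visits every nonempty open set at arbitrarily large times. -/
theorem exists_gt_linearFlow_mem {lam : d → ℝ}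
    (hlam : ∀ m : d → ℤ, ∑ i, m i * lam i = 0 → m = 0) (a : ℝ)
    {U : Set (UnitAddTorus d)} (hU : IsOpen U) {x : UnitAddTorus d} (hx : x ∈ U) :
    ∃ t > a, linearFlow lam t ∈ U := by
  by_contra! hne
  let K : TopologicalSpace.PositiveCompacts (UnitAddTorus d) :=
    ⟨⟨Set.univ, isCompact_univ⟩, by simp⟩
  let μ : Measure (UnitAddTorus d) := Measure.addHaarMeasure K
  have : IsProbabilityMeasure μ := ⟨Measure.addHaarMeasure_self (K₀ := K)⟩
  obtain ⟨g, hg0, hg1, hg⟩ := exists_continuous_zero_one_of_isClosed hU.isClosed_compl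
    (isClosed_singleton (x := x)) (by simpa using hx)
  have hgpos : 0 < ∫ y, g y ∂μ := by
    refine g.continuous.integral_pos_of_hasCompactSupport_nonneg_nonzero
      (HasCompactSupport.of_compactSpace _) (fun y => (hg y).1) (x := x) ?_
    rw [hg1 rfl]; simp
  -- A third suffices: the approximant's integral and the approximation error are each at most `ε`,
  -- against a total of `3 * ε`.
  set ε := (∫ y, g y ∂μ) / 3 with hε
  let G : C(UnitAddTorus d, ℂ) := ⟨fun y => (g y : ℂ), by fun_prop⟩
  have hG : G ∈ closure
      ((Submodule.span ℂ (Set.range (mFourier (d := d))) : Set C(UnitAddTorus d, ℂ))) := by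
    rw [← Submodule.topologicalClosure_coe, span_mFourier_closure_eq_top]
    trivial
  obtain ⟨h, hh, hdist⟩ := Metric.mem_closure_iff.1 hG ε (by positivity)
  have hnear : ∀ y, ‖G y - h y‖ ≤ ε := fun y => by
    rw [← dist_eq_norm]
    exact (ContinuousMap.dist_apply_le_dist y).trans hdist.le
  have hsmall : ‖∫ y, h y ∂μ‖ ≤ ε := by
    refine le_of_tendsto (tendsto_mean_linearFlow hlam a μ hh).norm ?_
    filter_upwards [eventually_gt_atTop 0] with T hT
    have : ‖∫ t in a..a + T, h (linearFlow lam t)‖ ≤ ε * |a + T - a| := by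
      refine intervalIntegral.norm_integral_le_of_norm_le_const fun t ht => ?_
      rw [Set.uIoc_of_le (by linarith)] at ht
      have h0 : G (linearFlow lam t) = 0 := by
        change ((g _ : ℝ) : ℂ) = 0
        rw [hg0 (hne t ht.1)]; simp
      simpa [h0] using hnear (linearFlow lam t)
    rw [add_sub_cancel_left, abs_of_pos hT] at this
    rw [norm_mul, norm_inv, Complex.norm_real, Real.norm_of_nonneg hT.le, inv_mul_le_iff₀ hT]
    linarith
  have hint' : ∀ f : C(UnitAddTorus d, ℂ), Integrable (fun x => f x) μ := fun f =>
    f.continuous.integrable_of_hasCompactSupport (HasCompactSupport.of_compactSpace _)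
  have hdiff : ‖∫ y, G y ∂μ - ∫ y, h y ∂μ‖ ≤ ε := by
    rw [← integral_sub (hint' G) (hint' h)]
    simpa using norm_integral_le_of_norm_le_const (μ := μ) (Eventually.of_forall hnear)
  have hGint : ‖∫ y, G y ∂μ‖ = 3 * ε := by
    have : ∫ y, G y ∂μ = ((∫ y, g y ∂μ : ℝ) : ℂ) := integral_ofReal
    rw [this, Complex.norm_real, Real.norm_of_nonneg hgpos.le, hε]
    ring
  have := norm_le_norm_add_norm_sub' (∫ y, G y ∂μ) (∫ y, h y ∂μ)
  have hεpos : 0 < ε := by positivity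
  linarith
end

/-! ### Steering the factors `k ^ (-it)` -/

theorem padicValRat_prod_zpow {s : Finset ℕ} (hs : ∀ q ∈ s, q.Prime) (m : ℕ → ℤ)
    (r : ℕ) [Fact r.Prime] :
    padicValRat r (∏ q ∈ s, (q : ℚ) ^ m q) = if r ∈ s then m r else 0 := by
  induction s using Finset.induction_on with
  | empty => simp
  | insert a s ha ih =>
    have hs' : ∀ q ∈ s, q.Prime := fun q hq => hs q (Finset.mem_insert_of_mem hq)
    have hne : ∀ q ∈ s, (q : ℚ) ^ m q ≠ 0 := fun q hq =>
      zpow_ne_zero _ (by exact_mod_cast (hs' q hq).ne_zero)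
    have hap := hs a (Finset.mem_insert_self _ _)
    have ha0 : (a : ℚ) ≠ 0 := by exact_mod_cast hap.ne_zero
    rw [Finset.prod_insert ha, padicValRat.mul (zpow_ne_zero _ ha0) (Finset.prod_ne_zero_iff.2 hne),
      ih hs', padicValRat.zpow, padicValRat.of_nat]
    by_cases hra : r = a
    · subst hra
      simp [ha, padicValNat_self]
    · have : padicValNat r a = 0 :=
        padicValNat.eq_zero_of_not_dvd fun h => hra ((Nat.prime_dvd_prime_iff_eq Fact.out hap).1 h)
      simp [this, hra]

/-- The logarithms of the primes are linearly independent over `ℤ`. -/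
theorem eq_zero_of_sum_mul_log_eq_zero {s : Finset ℕ} (hs : ∀ q ∈ s, q.Prime) (m : ℕ → ℤ)
    (h : ∑ q ∈ s, (m q : ℝ) * Real.log q = 0) {r : ℕ} (hr : r ∈ s) : m r = 0 := by
  have hpos : ∀ q ∈ s, (0 : ℝ) < q := fun q hq => by exact_mod_cast (hs q hq).pos
  have hR : (∏ q ∈ s, (q : ℝ) ^ m q) = 1 := by
    refine Real.eq_one_of_pos_of_log_eq_zero
      (Finset.prod_pos fun q hq => zpow_pos (hpos q hq) _) ?_
    rw [Real.log_prod fun q hq => (zpow_pos (hpos q hq) _).ne', ← h]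
    exact Finset.sum_congr rfl fun q _ => Real.log_zpow _ _
  have hQ : (∏ q ∈ s, (q : ℚ) ^ m q) = 1 := by
    refine Rat.cast_injective (α := ℝ) ?_
    push_cast
    exact hR
  have : Fact r.Prime := ⟨hs r hr⟩
  have hv := padicValRat_prod_zpow hs m r
  rw [hQ, if_pos hr] at hv
  simpa using hv.symm

/-- The exponent of the character of the torus that restricts to `t ↦ k ^ (-it)`. -/
def logExponent (n k : ℕ) : (n + 1).primesBelow → ℤ := fun q => -(k.factorization q : ℤ)

theorem mFourier_logExponent {n k : ℕ} (hk : k ≤ n) (t : ℝ) :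
    mFourier (logExponent n k)
        (linearFlow (fun q : (n + 1).primesBelow => Real.log q / (2 * Real.pi)) t) =
      exp (-(Real.log k : ℂ) * (t * I)) := by
  have hlog : Real.log k = ∑ q : (n + 1).primesBelow, (k.factorization q : ℝ) * Real.log q := by
    rw [Real.log_nat_eq_sum_factorization, Finset.sum_coe_sort (n + 1).primesBelow
      fun q => (k.factorization q : ℝ) * Real.log q]
    refine Finsupp.sum_of_support_subset _ (fun q hq => ?_) _ (by simp)
    rw [Nat.support_factorization] at hq
    exact Nat.mem_primesBelow.2
      ⟨by have := Nat.le_of_mem_primeFactors hq; omega, Nat.prime_of_mem_primeFactors hq⟩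
  rw [mFourier_linearFlow]
  congr 1
  have : (2 * Real.pi * ∑ q : (n + 1).primesBelow,
      (logExponent n k q : ℝ) * (Real.log q / (2 * Real.pi))) = -Real.log k := by
    rw [hlog, Finset.mul_sum, ← Finset.sum_neg_distrib]
    refine Finset.sum_congr rfl fun q _ => ?_
    simp only [logExponent]
    push_cast
    field_simp
  rw [this]
  push_cast; ring

theorem mFourier_logExponent_single {n k p : ℕ} (hk0 : k ≠ 0) (hkn : k ≤ n) (hp : p.Prime)
    (hpn : p ≤ n) (hnp : n < 2 * p) (θ : UnitAddCircle) :
    mFourier (logExponent n k) (fun q => if (q : ℕ) = p then θ else 0) =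
      if k = p then fourier (-1) θ else 1 := by
  simp only [mFourier, ContinuousMap.coe_mk, logExponent]
  have hpm : p ∈ (n + 1).primesBelow := Nat.mem_primesBelow.2 ⟨by omega, hp⟩
  rw [Finset.prod_eq_single (⟨p, hpm⟩ : (n + 1).primesBelow)]
  · rw [if_pos (show ((⟨p, hpm⟩ : (n + 1).primesBelow) : ℕ) = p from rfl)]
    split_ifs with h
    · rw [h, hp.factorization_self, Nat.cast_one]
    · have : k.factorization p = 0 := by
        refine Nat.factorization_eq_zero_of_not_dvd fun ⟨c, hc⟩ => ?_
        have hc2 : c < 2 := by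
          by_contra! h2
          have := Nat.mul_le_mul_left p h2
          omega
        interval_cases c <;> omega
      simp [this]
  · intro q _ hq
    have : (q : ℕ) ≠ p := fun h => hq (Subtype.ext h)
    simp [this]
  · simp

theorem exists_fourier_neg_one_eq {v : ℂ} (hv : ‖v‖ = 1) :
    ∃ θ : UnitAddCircle, fourier (-1) θ = v := by
  refine ⟨((-(arg v / (2 * Real.pi)) : ℝ) : UnitAddCircle), ?_⟩
  rw [fourier_coe_apply]
  conv_rhs => rw [← norm_mul_exp_arg_mul_I v, hv]
  have : (Real.pi : ℂ) ≠ 0 := by exact_mod_cast Real.pi_ne_zero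
  push_cast
  rw [one_mul]
  congr 1
  field_simp

/-- If `p ≤ n < 2 p`, then `p ^ (-it)` can be steered to any point of the circle while all other
`k ^ (-it)`, `k ≤ n`, are close to `1`. -/
theorem exists_gt_forall_norm_exp_sub_lt {n p : ℕ} (hp : p.Prime) (hpn : p ≤ n) (hnp : n < 2 * p)
    {v : ℂ} (hv : ‖v‖ = 1) {ε : ℝ} (hε : 0 < ε) (a : ℝ) :
    ∃ t > a, ∀ k ∈ Finset.Icc 1 n,
      ‖exp (-(Real.log k : ℂ) * (t * I)) - (if k = p then v else 1)‖ < ε := by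
  obtain ⟨θ, rfl⟩ := exists_fourier_neg_one_eq hv
  set U : Set (UnitAddTorus (n + 1).primesBelow) := ⋂ k ∈ Finset.Icc 1 n,
    {y | ‖mFourier (logExponent n k) y - (if k = p then fourier (-1) θ else 1)‖ < ε} with hU
  have hUo : IsOpen U := isOpen_biInter_finset fun k _ => isOpen_lt (by fun_prop) (by fun_prop)
  have hind : ∀ m : (n + 1).primesBelow → ℤ,
      ∑ q, (m q : ℝ) * (Real.log q / (2 * Real.pi)) = 0 → m = 0 := by
    intro m hm
    have h0 : ∑ q ∈ (n + 1).primesBelow,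
        ((if h : q ∈ (n + 1).primesBelow then m ⟨q, h⟩ else 0 : ℤ) : ℝ) * Real.log q = 0 := by
      rw [← Finset.sum_coe_sort]
      simp only [← mul_div_assoc, ← Finset.sum_div] at hm
      have hπ : 2 * Real.pi ≠ 0 := by positivity
      rw [← (div_eq_zero_iff.1 hm).resolve_right hπ]
      refine Finset.sum_congr rfl fun q _ => ?_
      rw [dif_pos q.2]
    funext q
    have := eq_zero_of_sum_mul_log_eq_zero
      (fun q hq => Nat.prime_of_mem_primesBelow hq)
      (fun q => if h : q ∈ (n + 1).primesBelow then m ⟨q, h⟩ else 0) h0 q.2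
    simpa using this
  obtain ⟨t, ht, htU⟩ := exists_gt_linearFlow_mem hind a hUo
    (x := fun q => if (q : ℕ) = p then θ else 0) (by
      simp only [hU, Set.mem_iInter, Set.mem_ofPred_eq, Finset.mem_Icc]
      intro k hk
      rw [mFourier_logExponent_single (by omega) hk.2 hp hpn hnp]
      simpa using hε)
  refine ⟨t, ht, fun k hk => ?_⟩
  simp only [hU, Set.mem_iInter, Set.mem_ofPred_eq] at htU
  rw [← mFourier_logExponent (Finset.mem_Icc.1 hk).2]
  exact htU k hk

/-! ### From one balanced point to infinitely many zeros -/

/-- A weak form of Hurwitz's theorem for entire functions. -/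
theorem exists_forall_near_exists_zero {F : ℂ → ℂ} (hF : Differentiable ℂ F) {z₀ : ℂ}
    (h0 : F z₀ = 0) {z₁ : ℂ} (h1 : F z₁ ≠ 0) {r : ℝ} (hr : 0 < r) :
    ∃ δ > 0, ∀ G : ℂ → ℂ, Differentiable ℂ G →
      (∀ z ∈ Metric.closedBall z₀ r, ‖G z - F z‖ < δ) → ∃ z ∈ Metric.closedBall z₀ r, G z = 0 := by
  have han : ∀ {G : ℂ → ℂ}, Differentiable ℂ G → AnalyticOnNhd ℂ G Set.univ := fun hG =>
    hG.differentiableOn.analyticOnNhd isOpen_univ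
  have hne : ∀ᶠ z in 𝓝[≠] z₀, F z ≠ 0 := by
    refine (han hF z₀ trivial).eventually_eq_zero_or_eventually_ne_zero.resolve_left fun h => h1 ?_
    exact congrFun ((han hF).eq_of_eventuallyEq (analyticOnNhd_const (v := (0 : ℂ))) h) z₁
  rw [eventually_nhdsWithin_iff, Metric.eventually_nhds_iff] at hne
  obtain ⟨η, hη, hball⟩ := hne
  set ρ := min (η / 2) r
  have hρ : 0 < ρ := lt_min (by positivity) hr
  have hsph : ∀ z ∈ Metric.sphere z₀ ρ, 0 < ‖F z‖ := by
    intro z hz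
    have hd : dist z z₀ = ρ := hz
    refine norm_pos_iff.2 (hball ?_ fun h => ?_)
    · rw [hd]; exact (min_le_left _ _).trans_lt (by linarith)
    · rw [Set.mem_singleton_iff.1 h, dist_self] at hd
      exact hρ.ne hd
  obtain ⟨y, hy, hmin⟩ := (isCompact_sphere z₀ ρ).exists_isMinOn
    (NormedSpace.sphere_nonempty.2 hρ.le) hF.continuous.norm.continuousOn
  set m := ‖F y‖
  have hm : 0 < m := hsph y hy
  -- On the sphere `G` differs from `G z₀` by at least `m - m / 4 - m / 4`, so the image covers the
  -- ball of radius `m / 4` about `G z₀`, which contains 0.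
  refine ⟨m / 4, by positivity, fun G hG hGF => ?_⟩
  have hsub : Metric.closedBall z₀ ρ ⊆ Metric.closedBall z₀ r :=
    Metric.closedBall_subset_closedBall (min_le_right _ _)
  have hG0 : ‖G z₀‖ < m / 4 := by simpa [h0] using hGF z₀ (Metric.mem_closedBall_self hr.le)
  have hGs : ∀ z ∈ Metric.sphere z₀ ρ, m / 2 ≤ ‖G z - G z₀‖ := by
    intro z hz
    have e1 := hGF z (hsub (Metric.sphere_subset_closedBall hz))
    have e2 : m ≤ ‖F z‖ := hmin hz
    have e3 := norm_sub_le (G z - G z₀) (G z - F z - G z₀)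
    have e4 : G z - G z₀ - (G z - F z - G z₀) = F z := by ring
    have e5 := norm_sub_le (G z - F z) (G z₀)
    rw [e4] at e3
    linarith
  have hfreq : ∃ᶠ z in 𝓝 z₀, G z ≠ G z₀ := by
    intro h
    simp only [not_not] at h
    have := congrFun ((han hG).eq_of_eventuallyEq (analyticOnNhd_const (v := G z₀)) h) y
    have h2 := hGs y hy
    rw [this] at h2
    simp at h2
    linarith
  obtain ⟨z, hz, hz0⟩ := hG.diffContOnCl.ball_subset_image_closedBall hρ hGs hfreq
    (show (0 : ℂ) ∈ _ by rw [Metric.mem_ball, dist_zero_left]; linarith)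
  exact ⟨z, hsub hz, hz0⟩

theorem one_div_natCast_cpow {k : ℕ} (hk : k ≠ 0) (z : ℂ) :
    1 / (k : ℂ) ^ z = exp (-(Real.log k : ℂ) * z) := by
  rw [Complex.cpow_def_of_ne_zero (by exact_mod_cast hk), one_div, ← Complex.exp_neg,
    Complex.natCast_log, neg_mul]

theorem zetaPartialSum_eq (n : ℕ) (z : ℂ) :
    zetaPartialSum n z = ∑ k ∈ Finset.Icc 1 n, exp (-(Real.log k : ℂ) * z) :=
  Finset.sum_congr rfl fun k hk =>
    one_div_natCast_cpow (by have := (Finset.mem_Icc.1 hk).1; omega) z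

/-- If `p ≤ n < 2 p` and at `w` the `p`-th term of `ζₙ` has the same absolute value as the sum of
the others, then `ζₙ` has infinitely many zeros arbitrarily close to the line `re z = re w`. -/
theorem infinite_zeros_near {n p : ℕ} (hp : p.Prime) (hpn : p ≤ n) (hnp : n < 2 * p) {w : ℂ}
    (hw : ‖∑ k ∈ (Finset.Icc 1 n).erase p, exp (-(Real.log k : ℂ) * w)‖ =
      ‖exp (-(Real.log p : ℂ) * w)‖) {r : ℝ} (hr : 0 < r) :
    {z : ℂ | zetaPartialSum n z = 0 ∧ |z.re - w.re| ≤ r}.Infinite := by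
  have hpmem : p ∈ Finset.Icc 1 n := Finset.mem_Icc.2 ⟨hp.one_lt.le, hpn⟩
  set v : ℂ := -(∑ k ∈ (Finset.Icc 1 n).erase p, exp (-(Real.log k : ℂ) * w)) /
    exp (-(Real.log p : ℂ) * w) with hv
  have hvn : ‖v‖ = 1 := by
    rw [hv, norm_div, norm_neg, hw, div_self (norm_ne_zero_iff.2 (Complex.exp_ne_zero _))]
  set F : ℂ → ℂ := fun z => ∑ k ∈ Finset.Icc 1 n,
    (if k = p then v else 1) * exp (-(Real.log k : ℂ) * z) with hF
  have hFd : Differentiable ℂ F := by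
    rw [hF]; fun_prop
  have hFe : ∀ z, F z = v * exp (-(Real.log p : ℂ) * z) +
      ∑ k ∈ (Finset.Icc 1 n).erase p, exp (-(Real.log k : ℂ) * z) := by
    intro z
    rw [hF]
    simp only
    rw [← Finset.add_sum_erase _ _ hpmem, if_pos rfl]
    congr 1
    refine Finset.sum_congr rfl fun k hk => ?_
    rw [if_neg (Finset.ne_of_mem_erase hk), one_mul]
  have hF0 : F w = 0 := by
    rw [hFe, hv, div_mul_cancel₀ _ (Complex.exp_ne_zero _), neg_add_cancel]
  have hF1 : F 1 ≠ 0 := by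
    intro h
    rw [hFe, add_eq_zero_iff_neg_eq] at h
    have h' := congrArg (‖·‖) h
    simp only [norm_neg, norm_mul, hvn, one_mul, norm_exp_neg_mul] at h'
    have hlt : Real.exp (-Real.log p * (1 : ℂ).re) < 1 := by
      rw [Real.exp_lt_one_iff]
      have := Real.log_pos (show (1 : ℝ) < p by exact_mod_cast hp.one_lt)
      simpa using this
    have hge : 1 ≤ ‖∑ k ∈ (Finset.Icc 1 n).erase p, exp (-(Real.log k : ℂ) * 1)‖ := by
      have hcast : ∑ k ∈ (Finset.Icc 1 n).erase p, exp (-(Real.log k : ℂ) * 1) =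
          ((∑ k ∈ (Finset.Icc 1 n).erase p, Real.exp (-Real.log k) : ℝ) : ℂ) := by
        simp
      rw [hcast, Complex.norm_real]
      refine le_trans ?_ (le_abs_self _)
      refine le_trans ?_ (Finset.single_le_sum (f := fun k : ℕ => Real.exp (-Real.log k))
        (fun k _ => (Real.exp_pos _).le)
        (Finset.mem_erase.2 ⟨hp.one_lt.ne, Finset.mem_Icc.2 ⟨le_rfl, hp.one_lt.le.trans hpn⟩⟩))
      simp
    linarith
  obtain ⟨δ, hδ, hG⟩ := exists_forall_near_exists_zero hFd hF0 hF1 hr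
  obtain ⟨B, hB⟩ := (isCompact_closedBall w r).bddAbove_image
    (f := fun z : ℂ => ∑ k ∈ Finset.Icc 1 n, ‖exp (-(Real.log k : ℂ) * z)‖)
    (Continuous.continuousOn (by fun_prop))
  have hB' : ∀ z ∈ Metric.closedBall w r,
      ∑ k ∈ Finset.Icc 1 n, ‖exp (-(Real.log k : ℂ) * z)‖ ≤ B := fun z hz =>
    hB (Set.mem_image_of_mem _ hz)
  have hB0 : 0 ≤ B := le_trans (Finset.sum_nonneg fun _ _ => norm_nonneg _)
    (hB' w (Metric.mem_closedBall_self hr.le))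
  have key : ∀ a : ℝ, ∃ z : ℂ, a < z.im ∧ zetaPartialSum n z = 0 ∧ |z.re - w.re| ≤ r := by
    intro a
    -- The lower bound on `t` offsets the at most `r` by which the zero can lie below `w`.
    obtain ⟨t, ht, hk⟩ := exists_gt_forall_norm_exp_sub_lt hp hpn hnp hvn
      (ε := δ / (B + 1)) (by positivity) (a - w.im + r)
    have hclose : ∀ z ∈ Metric.closedBall w r,
        ‖∑ k ∈ Finset.Icc 1 n, exp (-(Real.log k : ℂ) * (z + t * I)) - F z‖ < δ := by
      intro z hz
      rw [hF]
      simp only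
      rw [← Finset.sum_sub_distrib]
      calc _ ≤ ∑ k ∈ Finset.Icc 1 n, δ / (B + 1) * ‖exp (-(Real.log k : ℂ) * z)‖ := by
            refine norm_sum_le_of_le _ fun k hkm => ?_
            rw [mul_add, Complex.exp_add, mul_comm (exp _), ← sub_mul, norm_mul]
            exact mul_le_mul_of_nonneg_right (hk k hkm).le (norm_nonneg _)
        _ ≤ δ / (B + 1) * B := by
            rw [← Finset.mul_sum]
            exact mul_le_mul_of_nonneg_left (hB' z hz) (by positivity)
        _ < δ := by
            rw [div_mul_eq_mul_div, div_lt_iff₀ (by positivity)]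
            nlinarith
    obtain ⟨z, hz, hz0⟩ := hG
      (fun z => ∑ k ∈ Finset.Icc 1 n, exp (-(Real.log k : ℂ) * (z + t * I)))
      (by fun_prop) hclose
    have hzn : ‖z - w‖ ≤ r := by rwa [← dist_eq_norm]
    refine ⟨z + t * I, ?_, ?_, ?_⟩
    · have := (abs_le.1 ((Complex.abs_im_le_norm (z - w)).trans hzn)).1
      simp at this ⊢
      linarith
    · rw [zetaPartialSum_eq]; exact hz0
    · have := (Complex.abs_re_le_norm (z - w)).trans hzn
      simpa using this
  refine Set.Infinite.of_image Complex.im (Set.infinite_of_not_bddAbove ?_)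
  rintro ⟨b, hb⟩
  obtain ⟨z, hzb, hz⟩ := key b
  exact (hb (Set.mem_image_of_mem _ hz)).not_gt hzb

/-! ### Choice of the prime and of the balanced points -/

theorem exists_prime_lt_and_lt_two_mul {n : ℕ} (hn : 3 ≤ n) :
    ∃ p : ℕ, p.Prime ∧ p < n ∧ n < 2 * p := by
  obtain ⟨p, hp, h1, h2⟩ := Nat.exists_prime_lt_and_le_two_mul (n / 2) (by omega)
  -- Bertrand gives `p ≤ 2 * (n / 2)` with floor division, so `p = n` would be an even prime, hence
  -- 2.
  refine ⟨p, hp, lt_of_le_of_ne (by omega) ?_, by omega⟩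
  rintro rfl
  rcases hp.eq_two_or_odd with h | h <;> omega

theorem log_natCast_injOn : Set.InjOn (fun k : ℕ => Real.log k) (Set.Ici 1) := by
  intro a ha b hb h
  have ha' : (0 : ℝ) < a := by exact_mod_cast (Set.mem_Ici.1 ha)
  have hb' : (0 : ℝ) < b := by exact_mod_cast (Set.mem_Ici.1 hb)
  exact_mod_cast Real.log_injOn_pos ha' hb' h

theorem exists_balanced_re_pos {n p : ℕ} (hn : 3 ≤ n) (hp : p.Prime) :
    ∃ w : ℂ, 0 < w.re ∧ ‖∑ k ∈ (Finset.Icc 1 n).erase p, exp (-(Real.log k : ℂ) * w)‖ =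
      ‖exp (-(Real.log p : ℂ) * w)‖ := by
  have hne : ((Finset.Icc 2 n).erase p).Nonempty := by
    by_cases h : p = 2
    · exact ⟨3, by simp [h, hn]⟩
    · exact ⟨2, by simp; omega⟩
  have hpos : ∀ k ∈ (Finset.Icc 2 n).erase p, 0 < Real.log k := by
    intro k hk
    have := (Finset.mem_Icc.1 (Finset.mem_of_mem_erase hk)).1
    exact Real.log_pos (by exact_mod_cast this)
  have hinj : Set.InjOn (fun k : ℕ => Real.log k) ((Finset.Icc 2 n).erase p) := by
    refine log_natCast_injOn.mono fun k hk => ?_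
    have := (Finset.mem_Icc.1 (Finset.mem_of_mem_erase (Finset.mem_coe.1 hk))).1
    exact Set.mem_Ici.2 (by omega)
  obtain ⟨w, hw, h⟩ := exists_norm_expPoly_eq ((Finset.Icc 2 n).erase p)
    (fun k : ℕ => Real.log k) hne hpos hinj
    (mu := Real.log p) (Real.log_pos (by exact_mod_cast hp.one_lt))
  refine ⟨w, hw, ?_⟩
  rw [norm_exp_neg_mul, ← h, expPoly,
    ← Finset.add_sum_erase _ _ (Finset.mem_erase.2 ⟨hp.one_lt.ne, Finset.mem_Icc.2
      ⟨le_rfl, by omega⟩⟩ : 1 ∈ (Finset.Icc 1 n).erase p)]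
  have : ((Finset.Icc 1 n).erase p).erase 1 = (Finset.Icc 2 n).erase p := by
    ext k; simp only [Finset.mem_erase, Finset.mem_Icc]; omega
  rw [this]
  simp

/-- Dividing by the `n`-th term and replacing `z` by `-z` reduces to the right half-plane, with
frequencies `log n - log k`; `p < n` keeps `mu` positive. -/
theorem exists_balanced_re_neg {n p : ℕ} (hn : 3 ≤ n) (hp : p.Prime) (hpn : p < n) :
    ∃ w : ℂ, w.re < 0 ∧ ‖∑ k ∈ (Finset.Icc 1 n).erase p, exp (-(Real.log k : ℂ) * w)‖ =
      ‖exp (-(Real.log p : ℂ) * w)‖ := by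
  have hlog : ∀ k : ℕ, 0 < k → k < n → 0 < Real.log n - Real.log k := fun k hk0 hk =>
    sub_pos.2 (Real.log_lt_log (by exact_mod_cast hk0) (by exact_mod_cast hk))
  have hne : ((Finset.Icc 1 (n - 1)).erase p).Nonempty := by
    by_cases h : p = 1
    · exact absurd h hp.one_lt.ne'
    · exact ⟨1, by simp; omega⟩
  have hpos : ∀ k ∈ (Finset.Icc 1 (n - 1)).erase p, 0 < Real.log n - Real.log k := by
    intro k hk
    have := Finset.mem_Icc.1 (Finset.mem_of_mem_erase hk)
    exact hlog k (by omega) (by omega)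
  have hinj : Set.InjOn (fun k : ℕ => Real.log n - Real.log k) ((Finset.Icc 1 (n - 1)).erase p) := by
    intro a ha b hb hab
    have ha' := (Finset.mem_Icc.1 (Finset.mem_of_mem_erase (Finset.mem_coe.1 ha))).1
    have hb' := (Finset.mem_Icc.1 (Finset.mem_of_mem_erase (Finset.mem_coe.1 hb))).1
    exact log_natCast_injOn ha' hb' (sub_right_injective hab)
  obtain ⟨w, hw, h⟩ := exists_norm_expPoly_eq ((Finset.Icc 1 (n - 1)).erase p)
    (fun k : ℕ => Real.log n - Real.log k) hne hpos hinj
    (mu := Real.log n - Real.log p) (hlog p hp.pos hpn)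
  refine ⟨-w, by simpa using hw, ?_⟩
  have hn' : n ∈ (Finset.Icc 1 n).erase p :=
    Finset.mem_erase.2 ⟨hpn.ne', Finset.mem_Icc.2 ⟨by omega, le_rfl⟩⟩
  have hset : ((Finset.Icc 1 n).erase p).erase n = (Finset.Icc 1 (n - 1)).erase p := by
    ext k; simp only [Finset.mem_erase, Finset.mem_Icc]; omega
  have hfac : ∑ k ∈ (Finset.Icc 1 n).erase p, exp (-(Real.log k : ℂ) * -w) =
      exp (-(Real.log n : ℂ) * -w) * expPoly ((Finset.Icc 1 (n - 1)).erase p)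
        (fun k : ℕ => Real.log n - Real.log k) w := by
    rw [← Finset.add_sum_erase _ _ hn', hset, expPoly, mul_add, mul_one, Finset.mul_sum]
    congr 1
    refine Finset.sum_congr rfl fun k _ => ?_
    rw [← Complex.exp_add]
    push_cast
    ring_nf
  rw [hfac, norm_mul, h, norm_exp_neg_mul, norm_exp_neg_mul, ← Real.exp_add, Complex.neg_re]
  ring_nf

theorem re_eq_zero_of_zetaPartialSum_two_eq_zero {z : ℂ} (hz : zetaPartialSum 2 z = 0) :
    z.re = 0 := by
  rw [zetaPartialSum_eq, show Finset.Icc 1 2 = {1, 2} by rfl, Finset.sum_pair (by norm_num),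
    add_eq_zero_iff_neg_eq] at hz
  have h := congrArg (‖·‖) hz
  simp only [norm_neg, norm_exp_neg_mul] at h
  have h2 := Real.log_pos (show (1 : ℝ) < (2 : ℕ) by norm_num)
  have h3 := Real.exp_injective h
  rw [Nat.cast_one, Real.log_one, neg_zero, zero_mul, neg_mul, eq_comm, neg_eq_zero] at h3
  exact (mul_eq_zero.1 h3).resolve_left h2.ne'

theorem theorem2 :
    (∀ n : ℕ, 3 ≤ n →
      {z : ℂ | zetaPartialSum n z = 0 ∧ z.re < 0}.Infinite ∧
      {z : ℂ | zetaPartialSum n z = 0 ∧ 0 < z.re}.Infinite) ∧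
    (∀ z : ℂ, zetaPartialSum 2 z = 0 → z.re = 0) := by
  refine ⟨fun n hn => ?_, fun z => re_eq_zero_of_zetaPartialSum_two_eq_zero⟩
  obtain ⟨p, hp, hpn, hnp⟩ := exists_prime_lt_and_lt_two_mul hn
  constructor
  · obtain ⟨w, hw, h⟩ := exists_balanced_re_neg hn hp hpn
    -- Half the distance to the imaginary axis keeps the zeros in the open half-plane.
    refine (infinite_zeros_near hp hpn.le hnp h (r := -w.re / 2) (by linarith)).mono ?_
    rintro z ⟨hz, hzr⟩
    exact ⟨hz, by linarith [(abs_le.1 hzr).2]⟩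
  · obtain ⟨w, hw, h⟩ := exists_balanced_re_pos hn hp
    refine (infinite_zeros_near hp hpn.le hnp h (r := w.re / 2) (by linarith)).mono ?_
    rintro z ⟨hz, hzr⟩
    exact ⟨hz, by linarith [(abs_le.1 hzr).1]⟩
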